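/- **Protected linear bandit.** Let $\theta_0,\theta_1,\dots,\theta_L\in\mathbb R^d$ be unknown vectors, let $s$ be the dimension of the span of $\theta_1,\dots,\theta_L$, and let $\theta_\perp$ be the component of $\theta_0$ orthogonal to that span. In each round $t=1,\dots,T$ a finite non-empty set $\mathcal A_t\subset\mathbb R^d$ is drawn, independently over rounds, from a fixed law. An algorithm (possibly randomized) observes $\mathcal A_t$ and, using this and the record of all previous rounds, chooses an action $A_t\in\mathcal A_t$ and an index $I_t\in\{0,\dots,L\}$; it then observes $X_t=\langle A_t,\theta_{I_t}\rangle+\eta_t$, with i.i.d. noise $\eta_t$. Its regret is $$R=\mathbb E\sum_{t=1}^{T}\Bigl(\max_{a\in\mathcal A_t}\langle a,\theta_\perp\rangle-\langle A_t,\theta_\perp\rangle\Bigr).$$ **Theorem.** Let $T\ge 256$ be an integer, let $\alpha=T^{-1/4}$, and write $u_x=(\cos x,\sin x)\in\mathbb R^2$. Consider the following two instances with $d=2$ and $L=1$. In both, $\theta_0=u_{\pi/2-\alpha}$; the set $\mathcal A_t$ is $\{u_{\pi-\alpha},u_{2\alpha}\}$ or $\{u_{\pi-\alpha},u_{2\alpha},u_{\pi-3\alpha}\}$,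 each with probability $\tfrac12$; and the noise is Gaussian with mean $0$ and variance $\sigma^2\ge\tfrac12$ (for example, standard Gaussian). In instance $1$, $\theta_1=u_0$; in instance $2$, $\theta_1=u_{-\alpha}$. Then $s=1$ in both instances, the angle between the two protected vectors is $\alpha$, and every algorithm (which may depend on $T$, $\sigma$ and the two instances) has regrets $R_1$, $R_2$ on instances $1$, $2$ that satisfy $$\max\{R_1,R_2\}\ \ge\ \frac{e^{-21}}{16}\,T^{3/4}.$$ -/

import Mathlib

open MeasureTheory ProbabilityTheory
open scoped NNReal RealInnerProductSpace

namespace ProtectedBandit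

noncomputable section

/-- The ambient space `ℝ^d` with its Euclidean structure. -/
abbrev Vec (d : ℕ) : Type := EuclideanSpace ℝ (Fin d)

/-- An instance of the protected linear bandit problem in dimension `d`, with `L` protected
vectors, whose action sets are drawn independently in each round from `m` finite, non-empty sets
(the menus). The noise is independent over rounds, and subgaussian (hence centred). -/
structure Instance (d L m : ℕ) where
  /-- `θ 0` is the target vector, `θ 1, …, θ L` are the protected vectors. -/
  θ : Fin (L + 1) → Vec d
  /-- The possible action sets. -/
  menu : Fin m → Finset (Vec d)
  menu_nonempty : ∀ j, (menu j).Nonempty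
  /-- The law of the (index of the) action set of a round. -/
  menuLaw : PMF (Fin m)
  /-- The law of the noise of a round. -/
  noise : Measure ℝ
  noise_prob : IsProbabilityMeasure noise
  /-- The variance proxy `R²` of the noise. -/
  proxy : ℝ≥0
  noise_subgaussian : HasSubgaussianMGF (fun x : ℝ => x) proxy noise

/-- What is recorded in one round: the index of the action set offered, the action played,
the index of the vector queried, and the feedback received. -/
abbrev Round (d L m : ℕ) : Type := (Fin m × (Vec d × Fin (L + 1))) × ℝ

/-- The record of the first `t` rounds. -/
abbrev History (d L m t : ℕ) : Type := Fin t → Round d L m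

/-- A (possibly randomized) algorithm: given the record of the first `t` rounds and the action set
offered in the next one, it draws an action of that set and the index of a vector to be queried. -/
structure Policy {d m : ℕ} (L : ℕ) (menu : Fin m → Finset (Vec d)) where
  kernel : ∀ t : ℕ, Kernel (History d L m t × Fin m) (Vec d × Fin (L + 1))
  markov : ∀ t, IsMarkovKernel (kernel t)
  feasible : ∀ (t : ℕ) (h : History d L m t) (j : Fin m), ∀ᵐ p ∂(kernel t (h, j)), p.1 ∈ menu j

namespace Instance

variable {d L m : ℕ} (M : Instance d L m)

/-- The span of the protected vectors. -/
def protectedSpace : Submodule ℝ (Vec d) :=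
  Submodule.span ℝ (Set.range fun i : Fin L => M.θ i.succ)

/-- The component of the target vector that is orthogonal to the protected subspace. -/
def thetaPerp : Vec d := (M.protectedSpace)ᗮ.starProjection (M.θ 0)

/-- The largest expected reward of an action of the `j`-th menu. -/
def bestReward (j : Fin m) : ℝ :=
  (M.menu j).sup' (M.menu_nonempty j) fun a => ⟪a, M.thetaPerp⟫

/-- The feedback `⟪a, θ i⟫ + η` to the action `a` with the query `i`. -/
def feedback : Kernel (Vec d × Fin (L + 1)) ℝ where
  toFun p := M.noise.map fun η => ⟪p.1, M.θ p.2⟫ + η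
  measurable' := by
    have := M.noise_prob
    have hin : Measurable fun p : Vec d × Fin (L + 1) => ⟪p.1, M.θ p.2⟫ :=
      measurable_from_prod_countable_left fun i =>
        (continuous_id.inner (continuous_const (y := M.θ i))).measurable
    have hm : Measurable fun q : (Vec d × Fin (L + 1)) × ℝ => ⟪q.1.1, M.θ q.1.2⟫ + q.2 :=
      (hin.comp measurable_fst).add measurable_snd
    refine Measure.measurable_of_measurable_coe _ fun s hs => ?_
    convert measurable_measure_prodMk_left (ν := M.noise) (hm hs) using 2 with p
    exact Measure.map_apply (measurable_const_add _) hs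

instance : IsMarkovKernel M.feedback where
  isProbabilityMeasure p := by
    have := M.noise_prob
    exact Measure.isProbabilityMeasure_map (measurable_const_add _).aemeasurable

/-- One round of the interaction, given the record of the rounds before it. -/
def step (π : Policy L M.menu) (t : ℕ) : Kernel (History d L m t) (Round d L m) :=
  (Kernel.const _ M.menuLaw.toMeasure ⊗ₖ π.kernel t) ⊗ₖ
    Kernel.prodMkLeft _ (Kernel.prodMkLeft _ M.feedback)

/-- The law of the record of the first `t` rounds of the interaction of the algorithm `π` with the
instance `M`. -/
def law (π : Policy L M.menu) : (t : ℕ) → Measure (History d L m t)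
  | 0 => Measure.dirac Fin.elim0
  | t + 1 => (law π t ⊗ₘ M.step π t).map fun p =>
      (Fin.snoc (α := fun _ => Round d L m) p.1 p.2 : History d L m (t + 1))

instance (π : Policy L M.menu) (t : ℕ) : IsMarkovKernel (M.step π t) := by
  have := π.markov t
  unfold step
  infer_instance

instance (π : Policy L M.menu) (t : ℕ) : IsProbabilityMeasure (M.law π t) := by
  induction t with
  | zero => exact Measure.dirac.isProbabilityMeasure
  | succ t ih =>
    refine Measure.isProbabilityMeasure_map (Measurable.aemeasurable ?_)
    refine measurable_pi_lambda _ fun i => ?_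
    refine Fin.lastCases ?_ (fun i => ?_) i
    · simpa using measurable_snd
    · simpa [Function.comp_def] using
        (measurable_pi_apply (X := fun _ : Fin t => Round d L m) i).comp
          (measurable_fst (β := Round d L m))

/-- The pseudo-regret of the record `h` of the first `T` rounds. -/
def pseudoRegret {T : ℕ} (h : History d L m T) : ℝ :=
  ∑ t : Fin T, (M.bestReward (h t).1.1 - ⟪(h t).1.2.1, M.thetaPerp⟫)

/-- The (expected) regret of the algorithm `π` on the instance `M` over `T` rounds. -/
def regret (π : Policy L M.menu) (T : ℕ) : ℝ :=
  ∫ h, M.pseudoRegret h ∂(M.law π T)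

end Instance

/-- The unit vector of the plane at the angle `x`. -/
def u (x : ℝ) : Vec 2 := !₂[Real.cos x, Real.sin x]

open Classical in
/-- The two action sets. -/
def hardMenu (α : ℝ) : Fin 2 → Finset (Vec 2) :=
  ![{u (Real.pi - α), u (2 * α)}, {u (Real.pi - α), u (2 * α), u (Real.pi - 3 * α)}]

/-- The instance in the plane with the target vector at the angle `π / 2 - α`, one protected vector,
at the angle `φ`, each of the two action sets offered with probability `1 / 2`, and centred Gaussian
noise of variance `v`. -/
def hardInstance (α φ : ℝ) (v : ℝ≥0) : Instance 2 1 2 where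
  θ := ![u (Real.pi / 2 - α), u φ]
  menu := hardMenu α
  menu_nonempty j := by fin_cases j <;> simp [hardMenu]
  menuLaw := PMF.uniformOfFintype (Fin 2)
  noise := gaussianReal 0 v
  noise_prob := inferInstance
  proxy := v
  noise_subgaussian :=
    { integrable_exp_mul := fun t => integrable_exp_mul_gaussianReal t
      mgf_le := fun t => by
        rw [show (fun x : ℝ => x) = id from rfl, mgf_id_gaussianReal]
        simp }

end

end ProtectedBandit

open scoped ENNReal

namespace ProtectedBandit

/-! Two-point argument. Every action makes an angle at most `3 * α` with the line through `u 0`,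
where the cosine is flat: turning the protected vector from `0` to `-α` moves each feedback mean by
at most `5 / 2 * α ^ 2`. With `1 / 2 ≤ v` a round multiplies the second moment of the likelihood
ratio by at most `exp (25 / 2 * α ^ 4)`, and `T * α ^ 4 = 1` keeps the product over `T` rounds below
`exp (25 / 2)` (`sqDominated_law_hardInstance`).

The gaps, in contrast, are linear in `α`. On the three-action menu the orthogonal component favours
`w = u (π - 3α)` in the first instance and `u (2α)` in the second. Missing `w` in the first, or
playing it in the second, costs at least `α / 4` (`le_gap_zero`, `le_gap_neg`). As the laws are hard
to tell apart, the probabilities of these two mistakes have a sum bounded below in each round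
(`exp_le_real_law_add`); summing over rounds gives order `T * α = T ^ (3 / 4)`. -/

/-- Every square-integrable function is integrated by `ν` up to its second moment under `μ`: this
says that the second moment of the density of `ν` with respect to `μ` is at most `c`. -/
def SqDominated {X : Type*} [MeasurableSpace X] (c : ℝ≥0∞) (μ ν : Measure X) : Prop :=
  ∀ f : X → ℝ≥0∞, Measurable f → (∫⁻ x, f x ∂ν) ^ 2 ≤ c * ∫⁻ x, f x ^ 2 ∂μ

/-! ### Second-moment comparison of measures -/

section SqDominated

variable {X Y Z : Type*} [MeasurableSpace X] [MeasurableSpace Y] [MeasurableSpace Z]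

theorem sq_lintegral_mul_le (μ : Measure X) {f g : X → ℝ≥0∞} (hf : AEMeasurable f μ)
    (hg : AEMeasurable g μ) :
    (∫⁻ x, f x * g x ∂μ) ^ 2 ≤ (∫⁻ x, f x ^ 2 ∂μ) * ∫⁻ x, g x ^ 2 ∂μ := by
  have h := ENNReal.lintegral_mul_le_Lp_mul_Lq μ Real.HolderConjugate.two_two hf hg
  simp only [Pi.mul_apply, ENNReal.rpow_two] at h
  refine (pow_le_pow_left' h 2).trans_eq ?_
  rw [mul_pow, ← ENNReal.rpow_two, ← ENNReal.rpow_two, ← ENNReal.rpow_mul, ← ENNReal.rpow_mul]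
  norm_num

theorem SqDominated.refl (μ : Measure X) [IsProbabilityMeasure μ] : SqDominated 1 μ μ := by
  intro f hf
  simpa using sq_lintegral_mul_le μ hf.aemeasurable (aemeasurable_const (b := (1 : ℝ≥0∞)))

theorem SqDominated.mono {c c' : ℝ≥0∞} {μ ν : Measure X} (h : SqDominated c μ ν) (hc : c ≤ c') :
    SqDominated c' μ ν :=
  fun f hf => (h f hf).trans (by gcongr)

theorem SqDominated.map {c : ℝ≥0∞} {μ ν : Measure X} (h : SqDominated c μ ν) {φ : X → Y}
    (hφ : Measurable φ) : SqDominated c (μ.map φ) (ν.map φ) := by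
  intro f hf
  rw [lintegral_map hf hφ, lintegral_map (hf.pow_const 2) hφ]
  exact h _ (hf.comp hφ)

theorem SqDominated.sq_lintegral_le {c c' : ℝ≥0∞} {μ ν : Measure X} (h : SqDominated c μ ν)
    {g G : X → ℝ≥0∞} (hg : Measurable g) (hG : Measurable G)
    (hgG : ∀ᵐ x ∂μ, g x ^ 2 ≤ c' * G x) :
    (∫⁻ x, g x ∂ν) ^ 2 ≤ c * c' * ∫⁻ x, G x ∂μ := by
  refine (h g hg).trans ?_
  rw [mul_assoc, ← lintegral_const_mul _ hG]
  gcongr 1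
  exact lintegral_mono_ae hgG

/-- Integrating out the second coordinate reduces to the hypothesis on `μ` and `ν`; the conditional
bound is then needed only `μ`-almost everywhere. A uniform conditional bound thus makes constants
multiply even for adaptive data. -/
theorem SqDominated.compProd {c c' : ℝ≥0∞} {μ ν : Measure X} [SFinite μ] [SFinite ν]
    {κ η : Kernel X Y} [IsSFiniteKernel κ] [IsSFiniteKernel η] (h : SqDominated c μ ν)
    (h' : ∀ᵐ x ∂μ, SqDominated c' (κ x) (η x)) : SqDominated (c * c') (μ ⊗ₘ κ) (ν ⊗ₘ η) := by
  intro f hf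
  rw [Measure.lintegral_compProd hf, Measure.lintegral_compProd (hf.pow_const 2)]
  refine h.sq_lintegral_le hf.lintegral_kernel_prod_right'
    (hf.pow_const 2).lintegral_kernel_prod_right' ?_
  filter_upwards [h'] with x hx
  exact hx _ (hf.comp measurable_prodMk_left)

theorem SqDominated.kernel_compProd {c c' : ℝ≥0∞} {κ κ' : Kernel X Y} [IsSFiniteKernel κ]
    [IsSFiniteKernel κ'] {η η' : Kernel (X × Y) Z} [IsSFiniteKernel η] [IsSFiniteKernel η'] {x : X}
    (h : SqDominated c (κ x) (κ' x)) (h' : ∀ᵐ y ∂(κ x), SqDominated c' (η (x, y)) (η' (x, y))) :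
    SqDominated (c * c') ((κ ⊗ₖ η) x) ((κ' ⊗ₖ η') x) := by
  intro f hf
  rw [Kernel.lintegral_compProd _ _ _ hf, Kernel.lintegral_compProd _ _ _ (hf.pow_const 2)]
  refine h.sq_lintegral_le (hf.lintegral_kernel_prod_right'' (η := η'))
    ((hf.pow_const 2).lintegral_kernel_prod_right'' (η := η)) ?_
  filter_upwards [h'] with y hy
  exact hy _ (hf.comp measurable_prodMk_left)

theorem SqDominated.measure_sq_le {c : ℝ≥0∞} {μ ν : Measure X} (h : SqDominated c μ ν) {s : Set X}
    (hs : MeasurableSet s) : ν s ^ 2 ≤ c * μ s := by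
  have h1 := h (s.indicator 1) (measurable_one.indicator hs)
  have h2 : ∀ x, s.indicator (1 : X → ℝ≥0∞) x ^ 2 = s.indicator 1 x := fun x => by
    by_cases hx : x ∈ s <;> simp [hx]
  simpa only [h2, lintegral_indicator_one hs] using h1

theorem sqDominated_gaussianReal (a b : ℝ) {v : ℝ≥0} (hv : v ≠ 0) :
    SqDominated (ENNReal.ofReal (Real.exp ((b - a) ^ 2 / v))) (gaussianReal a v)
      (gaussianReal b v) := by
  intro f hf
  set e := Real.exp ((b - a) ^ 2 / (2 * v)) with he
  have hv' : (v : ℝ) ≠ 0 := by exact_mod_cast hv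
  -- Completing the square: `(x - a)² + (x - (2b - a))² = 2(x - b)² + 2(b - a)²`. The reflected mean
  -- `2b - a` lets Cauchy–Schwarz for Lebesgue measure give the sharp constant `e²`.
  have hpdf (x : ℝ) : gaussianPDFReal b v x =
      √(gaussianPDFReal a v x) * (e * √(gaussianPDFReal (2 * b - a) v x)) := by
    rw [mul_left_comm, ← Real.sqrt_mul (gaussianPDFReal_nonneg _ _ _)]
    simp only [gaussianPDFReal]
    rw [mul_mul_mul_comm, ← Real.exp_add, ← sq, Real.sqrt_mul (sq_nonneg _),
      Real.sqrt_sq (by positivity), ← Real.exp_half, mul_left_comm, he, ← Real.exp_add]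
    congr 2
    field_simp
    ring
  have hm (c : ℝ) : Measurable fun x => ENNReal.ofReal √(gaussianPDFReal c v x) :=
    ((measurable_gaussianPDFReal c v).sqrt).ennreal_ofReal
  have hsq (c x : ℝ) : ENNReal.ofReal √(gaussianPDFReal c v x) ^ 2 = gaussianPDF c v x := by
    rw [← ENNReal.ofReal_pow (Real.sqrt_nonneg _), Real.sq_sqrt (gaussianPDFReal_nonneg _ _ _),
      gaussianPDF_def]
  have hcs := sq_lintegral_mul_le volume (((hm a).mul hf).aemeasurable)
    (((hm (2 * b - a)).const_mul (ENNReal.ofReal e)).aemeasurable)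
  simp only [Pi.mul_apply, mul_pow, hsq] at hcs
  rw [lintegral_const_mul _ (measurable_gaussianPDF _ _), lintegral_gaussianPDF_eq_one _ hv,
    mul_one] at hcs
  rw [gaussianReal_of_var_ne_zero _ hv, gaussianReal_of_var_ne_zero _ hv,
    lintegral_withDensity_eq_lintegral_mul _ (measurable_gaussianPDF _ _) hf,
    lintegral_withDensity_eq_lintegral_mul _ (measurable_gaussianPDF _ _) (hf.pow_const 2),
    mul_comm (ENNReal.ofReal _)]
  convert hcs using 2
  · refine lintegral_congr fun x => ?_
    rw [Pi.mul_apply, gaussianPDF_def]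
    simp only
    rw [hpdf, ENNReal.ofReal_mul (Real.sqrt_nonneg _), ENNReal.ofReal_mul (Real.exp_pos _).le]
    ring
  · rfl
  · rw [← ENNReal.ofReal_pow (Real.exp_pos _).le, ← Real.exp_nat_mul]
    congr 2
    push_cast
    field_simp

end SqDominated

/-! ### Laws of the interaction and regret -/

namespace Instance

variable {d L m : ℕ} (M : Instance d L m)

theorem measurable_snoc (t : ℕ) :
    Measurable fun p : History d L m t × Round d L m =>
      (Fin.snoc (α := fun _ => Round d L m) p.1 p.2 : History d L m (t + 1)) := by
  refine measurable_pi_lambda _ fun i => Fin.lastCases ?_ (fun i => ?_) i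
  · simpa using measurable_snd
  · simpa [Function.comp_def] using
      (measurable_pi_apply (X := fun _ : Fin t => Round d L m) i).comp
        (measurable_fst (β := Round d L m))

theorem measurableSet_feasible (menu : Fin m → Finset (Vec d)) :
    MeasurableSet {q : Fin m × (Vec d × Fin (L + 1)) | q.2.1 ∈ menu q.1} := by
  have : {q : Fin m × (Vec d × Fin (L + 1)) | q.2.1 ∈ menu q.1} =
      ⋃ j, {q | q.1 = j} ∩ {q | q.2.1 ∈ (menu j : Set (Vec d))} := by
    ext q; simp
  rw [this]
  refine MeasurableSet.iUnion fun j => (measurable_fst (measurableSet_singleton j)).inter ?_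
  exact (measurable_fst.comp measurable_snd) (menu j).finite_toSet.measurableSet

theorem ae_feasible (π : Policy L M.menu) (t : ℕ) (h : History d L m t) :
    ∀ᵐ q ∂((Kernel.const _ M.menuLaw.toMeasure ⊗ₖ π.kernel t) h), q.2.1 ∈ M.menu q.1 := by
  have := π.markov t
  rw [Kernel.ae_compProd_iff (measurableSet_feasible M.menu)]
  exact Filter.Eventually.of_forall fun j => π.feasible t h j

/-- The same instance with other vectors. -/
abbrev withVectors (θ' : Fin (L + 1) → Vec d) : Instance d L m := { M with θ := θ' }

/-- The menu law and the policy kernel are common to both instances and contribute a factor `1`;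
only the feedback differs, and feasibility restricts it to actions on the menu. -/
theorem sqDominated_step (θ' : Fin (L + 1) → Vec d) {c : ℝ≥0∞}
    (hc : ∀ j, ∀ a ∈ M.menu j, ∀ i,
      SqDominated c (M.feedback (a, i)) ((M.withVectors θ').feedback (a, i)))
    (π : Policy L M.menu) (t : ℕ) (h : History d L m t) :
    SqDominated c (M.step π t h) ((M.withVectors θ').step π t h) := by
  have := π.markov t
  rw [← one_mul c]
  refine SqDominated.kernel_compProd (SqDominated.refl _) ?_
  filter_upwards [M.ae_feasible π t h] with q hq
  exact hc q.1 q.2.1 hq q.2.2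

theorem sqDominated_law (θ' : Fin (L + 1) → Vec d) {c : ℝ≥0∞}
    (hc : ∀ j, ∀ a ∈ M.menu j, ∀ i,
      SqDominated c (M.feedback (a, i)) ((M.withVectors θ').feedback (a, i)))
    (π : Policy L M.menu) (t : ℕ) :
    SqDominated (c ^ t) (M.law π t) ((M.withVectors θ').law π t) := by
  induction t with
  | zero => rw [pow_zero]; exact SqDominated.refl _
  | succ t ih =>
    rw [pow_succ]
    exact (ih.compProd (Filter.Eventually.of_forall (M.sqDominated_step θ' hc π t))).map
      (measurable_snoc t)

theorem law_coordinate (π : Policy L M.menu) {S : Set (Round d L m)} (hS : MeasurableSet S)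
    {p : ℝ≥0∞} (hp : ∀ t h, M.step π t h S = p) (T : ℕ) (t : Fin T) :
    M.law π T {h | h t ∈ S} = p := by
  induction T with
  | zero => exact t.elim0
  | succ T ih =>
    have hmeas (s : Fin (T + 1)) : MeasurableSet {h : History d L m (T + 1) | h s ∈ S} :=
      measurable_pi_apply s hS
    rw [law, Measure.map_apply (measurable_snoc T) (hmeas t),
      Measure.compProd_apply (measurable_snoc T (hmeas t))]
    induction t using Fin.lastCases with
    | last => simp [Set.preimage, hp]
    | cast s =>
      have hs : MeasurableSet {h : History d L m T | h s ∈ S} := measurable_pi_apply s hS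
      rw [← ih s, ← lintegral_indicator_one hs]
      refine lintegral_congr fun h => ?_
      by_cases hh : h s ∈ S <;> simp [Set.preimage, hh]

theorem law_feasible (π : Policy L M.menu) (T : ℕ) :
    ∀ᵐ h ∂(M.law π T), ∀ t, (h t).1.2.1 ∈ M.menu (h t).1.1 := by
  rw [ae_all_iff]
  intro t
  have hm : MeasurableSet {r : Round d L m | r.1.2.1 ∈ M.menu r.1.1} :=
    measurable_fst (measurableSet_feasible M.menu)
  -- Almost sure feasibility is the case `p = 0`, applied to the infeasible rounds.
  refine M.law_coordinate π hm.compl (fun t h => ?_) T t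
  have := π.markov t
  have h1 : ∀ᵐ r ∂(M.step π t h), r.1.2.1 ∈ M.menu r.1.1 := by
    rw [step, Kernel.ae_compProd_iff hm]
    filter_upwards [M.ae_feasible π t h] with q hq
    exact Filter.Eventually.of_forall fun _ => hq
  exact h1

theorem law_menu (π : Policy L M.menu) (T : ℕ) (t : Fin T) (j : Fin m) :
    M.law π T {h | (h t).1.1 = j} = M.menuLaw j := by
  have hm : MeasurableSet {r : Round d L m | r.1.1 = j} :=
    (measurable_fst.comp measurable_fst) (measurableSet_singleton j)
  refine M.law_coordinate π hm (fun t h => ?_) T t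
  have := π.markov t
  have h1 : ((M.step π t h).map Prod.fst).map Prod.fst = M.menuLaw.toMeasure := by
    rw [← Kernel.fst_apply, step, Kernel.fst_compProd, ← Kernel.fst_apply, Kernel.fst_compProd,
      Kernel.const_apply]
  rw [← PMF.toMeasure_apply_singleton _ _ (measurableSet_singleton j), ← h1,
    Measure.map_map measurable_fst measurable_fst,
    Measure.map_apply (measurable_fst.comp measurable_fst) (measurableSet_singleton j)]
  rfl

theorem inner_le_bestReward {j : Fin m} {a : Vec d} (ha : a ∈ M.menu j) :
    ⟪a, M.thetaPerp⟫ ≤ M.bestReward j :=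
  Finset.le_sup' (fun a => ⟪a, M.thetaPerp⟫) ha

theorem measurable_pseudoRegret (T : ℕ) :
    Measurable fun h : History d L m T => M.pseudoRegret h := by
  refine Finset.measurable_sum _ fun t _ => Measurable.sub ?_ ?_
  · exact (measurable_of_finite M.bestReward).comp
      (measurable_fst.comp (measurable_fst.comp (measurable_pi_apply t)))
  · exact (continuous_id.inner continuous_const).measurable.comp (measurable_fst.comp
      (measurable_snd.comp (measurable_fst.comp (measurable_pi_apply t))))

theorem integrable_pseudoRegret (π : Policy L M.menu) (T : ℕ) :
    Integrable (fun h => M.pseudoRegret h) (M.law π T) := by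
  refine Integrable.of_bound (M.measurable_pseudoRegret T).aestronglyMeasurable
    (∑ _t : Fin T, ∑ j, ∑ a ∈ M.menu j, |M.bestReward j - ⟪a, M.thetaPerp⟫|) ?_
  filter_upwards [M.law_feasible π T] with h hh
  refine (Finset.abs_sum_le_sum_abs _ _).trans (Finset.sum_le_sum fun t _ => ?_)
  refine le_trans ?_ (Finset.single_le_sum
    (f := fun j => ∑ a ∈ M.menu j, |M.bestReward j - ⟪a, M.thetaPerp⟫|)
    (fun j _ => Finset.sum_nonneg fun a _ => abs_nonneg _) (Finset.mem_univ (h t).1.1))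
  exact Finset.single_le_sum (f := fun a => |M.bestReward (h t).1.1 - ⟪a, M.thetaPerp⟫|)
    (fun a _ => abs_nonneg _) (hh t)

/-- If all actions in `B` have a gap of at least `g`, the regret is at least `g` times the expected
number of rounds in which an action in `B` is played. -/
theorem le_regret (π : Policy L M.menu) (T : ℕ) {B : Set (Fin m × Vec d)} (hB : MeasurableSet B)
    {g : ℝ}
    (hg : ∀ j, ∀ a ∈ M.menu j, (j, a) ∈ B → g ≤ M.bestReward j - ⟪a, M.thetaPerp⟫) :
    g * ∑ t : Fin T, (M.law π T).real {h | ((h t).1.1, (h t).1.2.1) ∈ B} ≤ M.regret π T := by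
  have hS (t : Fin T) : MeasurableSet {h : History d L m T | ((h t).1.1, (h t).1.2.1) ∈ B} :=
    (((measurable_fst.comp measurable_fst).prodMk
      (measurable_fst.comp (measurable_snd.comp measurable_fst))).comp (measurable_pi_apply t)) hB
  have hint (t : Fin T) : Integrable
      ({h : History d L m T | ((h t).1.1, (h t).1.2.1) ∈ B}.indicator (1 : History d L m T → ℝ)) (M.law π T) :=
    (integrable_const (1 : ℝ)).indicator (hS t)
  simp_rw [← fun t => integral_indicator_one (μ := M.law π T) (hS t)]
  rw [← integral_finsetSum _ fun t _ => hint t, ← integral_const_mul]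
  refine integral_mono_ae ((integrable_finsetSum _ fun t _ => hint t).const_mul g)
    (M.integrable_pseudoRegret π T) ?_
  filter_upwards [M.law_feasible π T] with h hh
  rw [Finset.mul_sum]
  refine Finset.sum_le_sum fun t _ => ?_
  by_cases ht : h ∈ {h : History d L m T | ((h t).1.1, (h t).1.2.1) ∈ B}
  · rw [Set.indicator_of_mem ht, Pi.one_apply, mul_one]
    exact hg _ _ (hh t) ht
  · rw [Set.indicator_of_notMem ht, mul_zero]
    exact sub_nonneg.2 (M.inner_le_bestReward (hh t))

end Instance

/-! ### Geometry and feedback of the hard instances -/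

theorem inner_u_u (x y : ℝ) : ⟪u x, u y⟫ = Real.cos (x - y) := by
  simp [u, PiLp.inner_apply, Fin.sum_univ_two, Real.cos_sub, mul_comm]

theorem norm_u (x : ℝ) : ‖u x‖ = 1 := by
  have h : ‖u x‖ ^ 2 = 1 := by rw [← real_inner_self_eq_norm_sq, inner_u_u]; simp
  exact (pow_eq_one_iff_of_nonneg (norm_nonneg _) two_ne_zero).1 h

theorem angle_u_u {x y : ℝ} (h : y ≤ x) (h' : x - y ≤ Real.pi) :
    InnerProductGeometry.angle (u x) (u y) = x - y := by
  rw [InnerProductGeometry.angle, inner_u_u, norm_u, norm_u, mul_one, div_one,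
    Real.arccos_cos (sub_nonneg.2 h) h']

section hardInstance

variable (α φ : ℝ) (v : ℝ≥0)

theorem protectedSpace_hardInstance :
    (hardInstance α φ v).protectedSpace = Submodule.span ℝ {u φ} := by
  rw [Instance.protectedSpace, Set.range_unique]
  rfl

theorem finrank_protectedSpace_hardInstance :
    Module.finrank ℝ (hardInstance α φ v).protectedSpace = 1 := by
  rw [protectedSpace_hardInstance]
  exact finrank_span_singleton (norm_ne_zero_iff.1 (by rw [norm_u]; exact one_ne_zero))

theorem inner_thetaPerp_hardInstance (x : ℝ) :
    ⟪u x, (hardInstance α φ v).thetaPerp⟫ = Real.sin (x - φ) * Real.cos (α + φ) := by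
  have h : (hardInstance α φ v).thetaPerp =
      u (Real.pi / 2 - α) - ⟪u φ, u (Real.pi / 2 - α)⟫ • u φ := by
    rw [Instance.thetaPerp, Submodule.starProjection_orthogonal_val]
    simp_rw [protectedSpace_hardInstance]
    rw [Submodule.starProjection_unit_singleton _ (norm_u φ)]
    rfl
  rw [h, inner_sub_right, inner_smul_right, inner_u_u, inner_u_u, inner_u_u,
    show x - (Real.pi / 2 - α) = x - φ + (α + φ) - Real.pi / 2 by ring,
    show φ - (Real.pi / 2 - α) = α + φ - Real.pi / 2 by ring, Real.cos_sub_pi_div_two,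
    Real.cos_sub_pi_div_two, Real.sin_add]
  ring

theorem feedback_hardInstance (p : Vec 2 × Fin 2) :
    (hardInstance α φ v).feedback p = gaussianReal ⟪p.1, (hardInstance α φ v).θ p.2⟫ v := by
  refine (gaussianReal_map_const_add _).trans ?_
  rw [zero_add]

theorem cos_sub_cos_sq_le (x y : ℝ) :
    (Real.cos x - Real.cos y) ^ 2 ≤ ((x + y) * (x - y) / 2) ^ 2 := by
  rw [Real.cos_sub_cos, sq_le_sq, abs_mul, abs_mul, abs_div, abs_mul]
  have h1 := Real.abs_sin_le_abs (x := (x + y) / 2)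
  have h2 := Real.abs_sin_le_abs (x := (x - y) / 2)
  rw [abs_div] at h1 h2
  have := mul_le_mul h1 h2 (abs_nonneg _) (by positivity)
  norm_num at this ⊢
  nlinarith

theorem sq_inner_sub_inner_le {j : Fin 2} {a : Vec 2} (ha : a ∈ hardMenu α j) :
    (⟪a, u (-α)⟫ - ⟪a, u 0⟫) ^ 2 ≤ 25 / 4 * α ^ 4 := by
  have h4 : 0 ≤ α ^ 4 := by positivity
  have key (x y : ℝ) (k : ℝ) (hk : (x + y) * (x - y) / 2 = k * α ^ 2) (hk' : k ^ 2 ≤ 25 / 4) :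
      (Real.cos x - Real.cos y) ^ 2 ≤ 25 / 4 * α ^ 4 := by
    refine (cos_sub_cos_sq_le x y).trans ?_
    rw [hk]
    nlinarith
  have h : a = u (Real.pi - α) ∨ a = u (2 * α) ∨ a = u (Real.pi - 3 * α) := by
    fin_cases j <;> simp [hardMenu] at ha <;> tauto
  obtain rfl | rfl | rfl := h <;> rw [inner_u_u, inner_u_u]
  · rw [show Real.pi - α - -α = Real.pi - 0 by ring,
      show Real.pi - α - 0 = Real.pi - α by ring, Real.cos_pi_sub, Real.cos_pi_sub, neg_sub_neg]
    exact key _ _ (1 / 2) (by ring) (by norm_num)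
  · exact key _ _ (5 / 2) (by ring) (by norm_num)
  · rw [show Real.pi - 3 * α - -α = Real.pi - 2 * α by ring,
      show Real.pi - 3 * α - 0 = Real.pi - 3 * α by ring, Real.cos_pi_sub, Real.cos_pi_sub,
      neg_sub_neg]
    exact key _ _ (5 / 2) (by ring) (by norm_num)

theorem sqDominated_feedback {v : ℝ≥0} (hv : 1 / 2 ≤ v) (j : Fin 2) (a : Vec 2)
    (ha : a ∈ hardMenu α j) (i : Fin 2) :
    SqDominated (ENNReal.ofReal (Real.exp (25 / 2 * α ^ 4)))
      ((hardInstance α 0 v).feedback (a, i)) ((hardInstance α (-α) v).feedback (a, i)) := by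
  have hv' : (1 / 2 : ℝ) ≤ v := by exact_mod_cast hv
  have hv0 : v ≠ 0 := by rintro rfl; norm_num at hv'
  have h4 : 0 ≤ α ^ 4 := by positivity
  rw [feedback_hardInstance, feedback_hardInstance]
  refine (sqDominated_gaussianReal _ _ hv0).mono
    (ENNReal.ofReal_le_ofReal (Real.exp_le_exp.2 ?_))
  rw [div_le_iff₀ (by linarith)]
  have h : (⟪a, (hardInstance α (-α) v).θ i⟫ - ⟪a, (hardInstance α 0 v).θ i⟫) ^ 2 ≤
      25 / 4 * α ^ 4 := by
    fin_cases i
    -- Querying the target, which the instances share, carries no information.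
    · simp only [hardInstance, Fin.zero_eta, Matrix.cons_val_zero, sub_self]
      linarith
    · exact sq_inner_sub_inner_le α ha
  nlinarith

theorem sqDominated_law_hardInstance {T : ℕ} (hT : T * α ^ 4 = 1) {v : ℝ≥0} (hv : 1 / 2 ≤ v)
    (π : Policy 1 (hardMenu α)) :
    SqDominated (ENNReal.ofReal (Real.exp (25 / 2))) ((hardInstance α 0 v).law π T)
      ((hardInstance α (-α) v).law π T) := by
  have h := (hardInstance α 0 v).sqDominated_law (hardInstance α (-α) v).θ
    (sqDominated_feedback α hv) π T
  rw [← ENNReal.ofReal_pow (Real.exp_pos _).le, ← Real.exp_nat_mul, mul_left_comm, hT,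
    mul_one] at h
  exact h

/-! ### Gaps and the two kinds of mistakes -/

variable {α}

theorem div_three_le_sin_sub_sin (h0 : 0 < α) (h1 : α ≤ 1 / 4) :
    α / 3 ≤ Real.sin (3 * α) - Real.sin (2 * α) := by
  rw [Real.sin_sub_sin, show (3 * α - 2 * α) / 2 = α / 2 by ring,
    show (3 * α + 2 * α) / 2 = 5 * α / 2 by ring]
  have hs := Real.sin_gt_sub_cube (half_pos h0)
  have hc := Real.one_sub_sq_div_two_le_cos (x := 5 * α / 2)
  have hs' : α * (49 / 100) ≤ Real.sin (α / 2) := by nlinarith [mul_pos h0 h0]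
  have hc' : 4 / 5 ≤ Real.cos (5 * α / 2) := by nlinarith
  nlinarith

/-- The rewards are `cos α` times `sin α`, `sin (2α)`, `sin (3α)`, so the runner-up is `u (2α)`; the
factor `cos α` reduces `α / 3` to `α / 4`. -/
theorem le_gap_zero (h0 : 0 < α) (h1 : α ≤ 1 / 4) {a : Vec 2} (ha : a ∈ hardMenu α 1)
    (hne : a ≠ u (Real.pi - 3 * α)) :
    α / 4 ≤ (hardInstance α 0 v).bestReward 1 - ⟪a, (hardInstance α 0 v).thetaPerp⟫ := by
  have hw := (hardInstance α 0 v).inner_le_bestReward (j := 1) (a := u (Real.pi - 3 * α))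
    (by simp [hardInstance, hardMenu])
  have hs := div_three_le_sin_sub_sin h0 h1
  have hc := Real.one_sub_sq_div_two_le_cos (x := α)
  have hc' : 31 / 32 ≤ Real.cos α := by nlinarith
  have hmono : Real.sin α ≤ Real.sin (2 * α) := by
    apply Real.sin_le_sin_of_le_of_le_pi_div_two <;> linarith [Real.pi_gt_three]
  have h : a = u (Real.pi - α) ∨ a = u (2 * α) := by
    simp [hardMenu] at ha; tauto
  rw [inner_thetaPerp_hardInstance, sub_zero, add_zero, Real.sin_pi_sub] at hw
  obtain rfl | rfl := h <;> rw [inner_thetaPerp_hardInstance, sub_zero, add_zero]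
  · rw [Real.sin_pi_sub]
    nlinarith
  · nlinarith

theorem le_gap_neg (h0 : 0 < α) (h1 : α ≤ 1 / 4) :
    α / 4 ≤ (hardInstance α (-α) v).bestReward 1 -
      ⟪u (Real.pi - 3 * α), (hardInstance α (-α) v).thetaPerp⟫ := by
  have hw := (hardInstance α (-α) v).inner_le_bestReward (j := 1) (a := u (2 * α))
    (by simp [hardInstance, hardMenu])
  have hs := div_three_le_sin_sub_sin h0 h1
  rw [inner_thetaPerp_hardInstance, add_neg_cancel, Real.cos_zero, mul_one,
    show 2 * α - -α = 3 * α by ring] at hw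
  rw [inner_thetaPerp_hardInstance, add_neg_cancel, Real.cos_zero, mul_one,
    show Real.pi - 3 * α - -α = Real.pi - 2 * α by ring, Real.sin_pi_sub]
  linarith

/-- In every round, one of the two kinds of mistakes is likely on one of the two instances. -/
theorem exp_le_real_law_add {T : ℕ} (hT : T * α ^ 4 = 1) {v : ℝ≥0} (hv : 1 / 2 ≤ v)
    (π : Policy 1 (hardMenu α)) (t : Fin T) (w : Vec 2) :
    Real.exp (-(25 / 2)) / 4 ≤
      ((hardInstance α 0 v).law π T).real
        {h | ((h t).1.1, (h t).1.2.1) ∈ {q : Fin 2 × Vec 2 | q.1 = 1 ∧ q.2 ≠ w}} +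
      ((hardInstance α (-α) v).law π T).real
        {h | ((h t).1.1, (h t).1.2.1) ∈ {q : Fin 2 × Vec 2 | q.1 = 1 ∧ q.2 = w}} := by
  set A := {h : History 2 1 2 T |
    ((h t).1.1, (h t).1.2.1) ∈ {q : Fin 2 × Vec 2 | q.1 = 1 ∧ q.2 ≠ w}}
  set A' := {h : History 2 1 2 T |
    ((h t).1.1, (h t).1.2.1) ∈ {q : Fin 2 × Vec 2 | q.1 = 1 ∧ q.2 = w}}
  have hj : Measurable fun h : History 2 1 2 T => (h t).1.1 :=
    (measurable_fst.comp measurable_fst).comp (measurable_pi_apply t)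
  have ha : Measurable fun h : History 2 1 2 T => (h t).1.2.1 :=
    (measurable_fst.comp (measurable_snd.comp measurable_fst)).comp (measurable_pi_apply t)
  have hA : MeasurableSet A :=
    (hj (measurableSet_singleton 1)).inter (ha (measurableSet_singleton w).compl)
  have hA' : MeasurableSet A' :=
    (hj (measurableSet_singleton 1)).inter (ha (measurableSet_singleton w))
  have hprob (M : Instance 2 1 2) (π : Policy 1 M.menu) : IsProbabilityMeasure (M.law π T) :=
    inferInstance
  have := hprob (hardInstance α 0 v) π
  have := hprob (hardInstance α (-α) v) π
  have hsum : ((hardInstance α (-α) v).law π T).real A +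
      ((hardInstance α (-α) v).law π T).real A' = 1 / 2 := by
    rw [← measureReal_union _ hA']
    · have hu : A ∪ A' = {h | (h t).1.1 = 1} := by
        ext h
        simp only [A, A', Set.mem_union, Set.mem_ofPred_eq]
        tauto
      rw [hu, measureReal_def,
        show (hardInstance α (-α) v).law π T {h | (h t).1.1 = 1} =
          (hardInstance α (-α) v).menuLaw 1 from
          (hardInstance α (-α) v).law_menu π T t 1]
      simp [hardInstance]
    · exact Set.disjoint_left.2 fun h h1 h2 => h1.2 h2.2
  have hsq : ((hardInstance α (-α) v).law π T).real A ^ 2 ≤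
      Real.exp (25 / 2) * ((hardInstance α 0 v).law π T).real A := by
    have h := ENNReal.toReal_mono (ENNReal.mul_ne_top ENNReal.ofReal_ne_top (measure_ne_top _ _))
      ((sqDominated_law_hardInstance α hT hv π).measure_sq_le hA)
    rwa [ENNReal.toReal_pow, ENNReal.toReal_mul, ENNReal.toReal_ofReal (Real.exp_pos _).le] at h
  have hC : 1 ≤ Real.exp (25 / 2) := Real.one_le_exp (by norm_num)
  have hz : 0 ≤ ((hardInstance α (-α) v).law π T).real A' := measureReal_nonneg
  rw [Real.exp_neg, div_le_iff₀ (by norm_num), inv_le_iff_one_le_mul₀ (Real.exp_pos _)]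
  -- With `x` and `z = 1 / 2 - x` the probabilities of `A` and `A'` in the second instance and `C =
  -- exp (25 / 2)`, the sum times `C` is at least `x² + C * z ≥ x² + 1 / 2 - x ≥ 1 / 4`.
  nlinarith [sq_nonneg (((hardInstance α (-α) v).law π T).real A - 1 / 2)]

end hardInstance

end ProtectedBandit

theorem mainTheorem3 (T : ℕ) (hT : 256 ≤ T) (v : ℝ≥0) (hv : 1 / 2 ≤ v) (α : ℝ)
    (hα : α = (T : ℝ) ^ (-(1 / 4) : ℝ)) :
    Module.finrank ℝ (ProtectedBandit.hardInstance α 0 v).protectedSpace = 1 ∧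
    Module.finrank ℝ (ProtectedBandit.hardInstance α (-α) v).protectedSpace = 1 ∧
    InnerProductGeometry.angle ((ProtectedBandit.hardInstance α 0 v).θ 1)
      ((ProtectedBandit.hardInstance α (-α) v).θ 1) = α ∧
    ∀ π : ProtectedBandit.Policy 1 (ProtectedBandit.hardMenu α),
      Real.exp (-21) / 16 * (T : ℝ) ^ (3 / 4 : ℝ) ≤
        max ((ProtectedBandit.hardInstance α 0 v).regret π T)
          ((ProtectedBandit.hardInstance α (-α) v).regret π T) := by
  have hT' : (256 : ℝ) ≤ T := by exact_mod_cast hT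
  have hT0 : (0 : ℝ) < T := by linarith
  have h0 : 0 < α := hα ▸ Real.rpow_pos_of_pos hT0 _
  have hT4 : T * α ^ 4 = 1 := by
    rw [hα, ← Real.rpow_natCast, ← Real.rpow_mul hT0.le]
    norm_num
    rw [Real.rpow_neg_one, mul_inv_cancel₀ hT0.ne']
  have h1 : α ≤ 1 / 4 := by
    refine le_of_pow_le_pow_left₀ (n := 4) (by norm_num) (by norm_num) ?_
    nlinarith [pow_pos h0 4]
  have hTα : (T : ℝ) ^ (3 / 4 : ℝ) = T * α := by
    rw [hα, mul_comm, ← Real.rpow_add_one hT0.ne']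
    norm_num
  refine ⟨ProtectedBandit.finrank_protectedSpace_hardInstance _ _ _,
    ProtectedBandit.finrank_protectedSpace_hardInstance _ _ _, ?_, fun π => ?_⟩
  · refine (ProtectedBandit.angle_u_u (by linarith) (by linarith [Real.pi_gt_three])).trans ?_
    ring
  have hj : Measurable fun q : Fin 2 × ProtectedBandit.Vec 2 => q.1 := measurable_fst
  have ha : Measurable fun q : Fin 2 × ProtectedBandit.Vec 2 => q.2 := measurable_snd
  have hR1 := (ProtectedBandit.hardInstance α 0 v).le_regret π T
    (B := {q | q.1 = 1 ∧ q.2 ≠ ProtectedBandit.u (Real.pi - 3 * α)}) (g := α / 4)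
    ((hj (measurableSet_singleton 1)).inter (ha (measurableSet_singleton _).compl)) <| by
      rintro j a hja ⟨rfl, hne⟩
      exact ProtectedBandit.le_gap_zero v h0 h1 hja hne
  have hR2 := (ProtectedBandit.hardInstance α (-α) v).le_regret π T
    (B := {q | q.1 = 1 ∧ q.2 = ProtectedBandit.u (Real.pi - 3 * α)}) (g := α / 4)
    ((hj (measurableSet_singleton 1)).inter (ha (measurableSet_singleton _))) <| by
      rintro j a hja ⟨rfl, rfl⟩
      exact ProtectedBandit.le_gap_neg v h0 h1
  have hsum := Finset.sum_le_sum fun (t : Fin T) (_ : t ∈ Finset.univ) =>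
    ProtectedBandit.exp_le_real_law_add hT4 hv π t (ProtectedBandit.u (Real.pi - 3 * α))
  rw [Finset.sum_add_distrib, Finset.sum_const, Finset.card_univ, Fintype.card_fin,
    nsmul_eq_mul] at hsum
  have hmul := mul_le_mul_of_nonneg_left hsum (div_pos h0 four_pos).le
  -- The maximum is at least half the sum of the regrets, hence at least `exp (-(25 / 2)) / 32 * (T
  -- * α)`; the stated constant leaves slack.
  have he : Real.exp (-21) * 2 ≤ Real.exp (-(25 / 2)) := by
    rw [show (-(25 / 2) : ℝ) = -21 + 17 / 2 by norm_num, Real.exp_add]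
    gcongr
    linarith [Real.add_one_le_exp (17 / 2)]
  have hm1 := le_max_left ((ProtectedBandit.hardInstance α 0 v).regret π T)
    ((ProtectedBandit.hardInstance α (-α) v).regret π T)
  have hm2 := le_max_right ((ProtectedBandit.hardInstance α 0 v).regret π T)
    ((ProtectedBandit.hardInstance α (-α) v).regret π T)
  have hfin := mul_le_mul_of_nonneg_left he (mul_pos hT0 h0).le
  rw [hTα]
  linarith
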